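/- \textbf{Theorem.} Let $B=(V,E)$ be a simple Bratteli diagram whose infinite path space $X_B$ is infinite, and let $G_B$ be the associated full group. Then $G_B$ has the ISR property. Here a \emph{Bratteli diagram} consists of finite sets of vertices $V_n$ ($n\ge 0$) with $V_0=\{v_0\}$ a single point, finite sets of edges $E_n$ ($n\ge 1$), and surjective source and range maps $s:E_n\to V_{n-1}$ and $r:E_n\to V_n$. It is \emph{simple} if for every $n\ge 1$ there is $m>n$ such that every vertex of $V_n$ is connected by a path to every vertex of $V_m$. $X_B=\{(e_n)_{n\ge1}\in\prod_{n\ge 1} E_n : s(e_{n+1})=r(e_n)\ \forall n\ge1\}$ is the space of infinite paths starting at $v_0$, with the topology induced by the product of the discrete topologies. Let $G_n$ be the group of homeomorphisms of $X_B$ that permute only the initial segments $(e_1,\dots,e_n)$ of infinite paths (all later edges are kept, and the new initial segment depends only on the old one). Then $G_B=\bigcup_{n\ge1}G_n$. For a group $G$ and $g\in G$ let $u_g$ be the unitary operator on $\ell^2(G)$ with $u_g\delta_s=\delta_{gs}$, and for a subgroup $H\le G$ let $L(H)\subseteq B(\ell^2(G))$ be the von Neumann algebra generated by $\{u_h:h\in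 H\}$. The countable group $G$ has the \emph{ISR property} (invariant von Neumann subalgebras rigidity property) if for every (unital) von Neumann subalgebra $P\subseteq L(G)$ with $u_gPu_g^*=P$ for all $g\in G$ there is a normal subgroup $H\lhd G$ such that $P=L(H)$. -/

import Mathlib

/-! ### Group von Neumann algebras and the ISR property -/

/-- The Hilbert space `ℓ²(G)`. -/
abbrev EllTwo (G : Type*) : Type _ := lp (fun _ : G => ℂ) 2

theorem memEllTwo_translate {G : Type*} [Group G] (f : EllTwo G) (g : G) :
    Memℓp (fun s : G => f (g * s)) 2 := by
  have h2 : 0 < (2 : ENNReal).toReal := by norm_num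
  have hf : Summable fun s : G => ‖f s‖ ^ (2 : ENNReal).toReal := f.2.summable h2
  exact memℓp_gen (hf.comp_injective (mul_right_injective g))

/-- The left regular representation: `(u_g f)(s) = f (g⁻¹ s)`, as a linear isometric
automorphism of `ℓ²(G)`. -/
noncomputable def leftRegularIso {G : Type*} [Group G] (g : G) : EllTwo G ≃ₗᵢ[ℂ] EllTwo G where
  toFun f := ⟨fun s => f (g⁻¹ * s), memEllTwo_translate f g⁻¹⟩
  invFun f := ⟨fun s => f (g * s), memEllTwo_translate f g⟩
  map_add' f f' := by ext s; rfl
  map_smul' c f := by ext s; rfl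
  left_inv f := by ext s; simp
  right_inv f := by ext s; simp
  norm_map' f := by
    have h2 : 0 < (2 : ENNReal).toReal := by norm_num
    rw [lp.norm_eq_tsum_rpow h2, lp.norm_eq_tsum_rpow h2]
    congr 1
    exact (Equiv.mulLeft g⁻¹).tsum_eq (fun s : G => ‖f s‖ ^ (2 : ENNReal).toReal)

/-- The unitary operator `u_g` on `ℓ²(G)`. -/
noncomputable def leftRegular {G : Type*} [Group G] (g : G) : EllTwo G →L[ℂ] EllTwo G :=
  ((leftRegularIso g).toContinuousLinearEquiv : EllTwo G →L[ℂ] EllTwo G)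

/-- `u_g δ_s = δ_{gs}`. -/
theorem leftRegular_single {G : Type*} [Group G] [DecidableEq G] (g s : G) :
    leftRegular g (lp.single 2 s (1 : ℂ)) = lp.single 2 (g * s) (1 : ℂ) := by
  ext t
  change (lp.single 2 s (1 : ℂ) : EllTwo G) (g⁻¹ * t) = _
  simp [Pi.single_apply, inv_mul_eq_iff_eq_mul]

/-- The von Neumann algebra generated by a set `S` of bounded operators, i.e. the double
commutant `(S ∪ S*)''`; by the bicommutant theorem it is also the weak operator closure of the
unital `*`-algebra generated by `S`. -/
noncomputable def vonNeumannGenerated {H : Type*} [NormedAddCommGroup H]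
    [InnerProductSpace ℂ H] [CompleteSpace H] (S : Set (H →L[ℂ] H)) : VonNeumannAlgebra H where
  toStarSubalgebra :=
    StarSubalgebra.centralizer ℂ (StarSubalgebra.centralizer ℂ S : Set (H →L[ℂ] H))
  centralizer_centralizer' := by simp

/-- `L(H)` for a subgroup `H` of `G`, as a von Neumann algebra on `ℓ²(G)`: it is generated by
the operators `u_h`, `h ∈ H`. In particular `L(G)` is `subgroupVN (⊤ : Subgroup G)`. -/
noncomputable def subgroupVN {G : Type*} [Group G] (H : Subgroup G) :
    VonNeumannAlgebra (EllTwo G) :=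
  vonNeumannGenerated (leftRegular '' (H : Set G))

/-- `P` is `G`-invariant: `u_g P u_g* = P` for all `g ∈ G`. -/
def IsInvariantVN {G : Type*} [Group G] (P : VonNeumannAlgebra (EllTwo G)) : Prop :=
  ∀ g : G, (fun x : EllTwo G →L[ℂ] EllTwo G => leftRegular g * x * star (leftRegular g)) ''
    (P : Set (EllTwo G →L[ℂ] EllTwo G)) = (P : Set (EllTwo G →L[ℂ] EllTwo G))

/-- The invariant von Neumann subalgebras rigidity (ISR) property. -/
def HasISRProperty (G : Type*) [Group G] : Prop :=
  ∀ P : VonNeumannAlgebra (EllTwo G), P ≤ subgroupVN (⊤ : Subgroup G) → IsInvariantVN P →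
    ∃ H : Subgroup G, H.Normal ∧ P = subgroupVN H

/-! ### Bratteli diagrams and their full groups -/

/-- A Bratteli diagram. `V n` is the `n`-th level of vertices and `E n` is the set of edges from
level `n` to level `n + 1`. -/
structure BratteliDiagram where
  V : ℕ → Type*
  E : ℕ → Type*
  finite_V : ∀ n, Finite (V n)
  finite_E : ∀ n, Finite (E n)
  root : V 0
  eq_root : ∀ v : V 0, v = root
  s : ∀ {n : ℕ}, E n → V n
  r : ∀ {n : ℕ}, E n → V (n + 1)
  s_surjective : ∀ n, Function.Surjective (s : E n → V n)
  r_surjective : ∀ n, Function.Surjective (r : E n → V (n + 1))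

namespace BratteliDiagram

/-- `B.Connected v w`: there is a finite path of edges going from the vertex `v` down to `w`. -/
inductive Connected (B : BratteliDiagram) {n : ℕ} (v : B.V n) : ∀ {m : ℕ}, B.V m → Prop
  | refl : Connected B v v
  | step {m : ℕ} (e : B.E m) : Connected B v (B.s e) → Connected B v (B.r e)

/-- `B` is simple: for every `n ≥ 1` there is `m > n` such that every vertex in `V n` is
connected to every vertex in `V m`. -/
def IsSimple (B : BratteliDiagram) : Prop :=
  ∀ n : ℕ, 1 ≤ n → ∃ m : ℕ, n < m ∧ ∀ (v : B.V n) (w : B.V m), B.Connected v w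

/-- The space `X_B` of infinite paths starting at the root. -/
def PathSpace (B : BratteliDiagram) : Type _ :=
  {x : ∀ n, B.E n // ∀ n, B.s (x (n + 1)) = B.r (x n)}

/-- The finite sets of edges carry the discrete topology. -/
instance (B : BratteliDiagram) (n : ℕ) : TopologicalSpace (B.E n) := ⊥

instance (B : BratteliDiagram) (n : ℕ) : DiscreteTopology (B.E n) := ⟨rfl⟩

/-- The topology of `X_B` is the subspace topology of the product topology. -/
instance (B : BratteliDiagram) : TopologicalSpace B.PathSpace :=
  inferInstanceAs (TopologicalSpace {x : ∀ n, B.E n // ∀ n, B.s (x (n + 1)) = B.r (x n)})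

/-- The group `G_n` of homeomorphisms of `X_B` that permute only the initial segments of length
`n` of the infinite paths: all edges after the first `n` are kept, and the initial segment of
length `n` of the image is determined by, and determines, the one of the argument. -/
def levelGroup (B : BratteliDiagram) (n : ℕ) : Subgroup (B.PathSpace ≃ₜ B.PathSpace) where
  carrier := {h | (∀ x : B.PathSpace, ∀ k, n ≤ k → (h x).1 k = x.1 k) ∧
    ∀ x y : B.PathSpace, (∀ k, k < n → (h x).1 k = (h y).1 k) ↔ ∀ k, k < n → x.1 k = y.1 k}
  one_mem' := ⟨fun _ _ _ => rfl, fun _ _ => Iff.rfl⟩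
  mul_mem' {a b} ha hb :=
    ⟨fun x k hk => (ha.1 (b x) k hk).trans (hb.1 x k hk),
      fun x y => (ha.2 (b x) (b y)).trans (hb.2 x y)⟩
  inv_mem' {a} ha := by
    have h : ∀ x, a (a⁻¹ x) = x := fun x => a.apply_symm_apply x
    refine ⟨fun x k hk => ?_, fun x y => ?_⟩
    · have := ha.1 (a⁻¹ x) k hk
      rw [h] at this
      exact this.symm
    · have := ha.2 (a⁻¹ x) (a⁻¹ y)
      rw [h, h] at this
      exact this.symm

theorem levelGroup_mono (B : BratteliDiagram) : Monotone B.levelGroup := by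
  refine monotone_nat_of_le_succ fun n h hh => ⟨fun x k hk => hh.1 x k (by omega), fun x y => ?_⟩
  simp only [Nat.forall_lt_succ_right]
  rw [hh.2 x y, hh.1 x n le_rfl, hh.1 y n le_rfl]

/-- The full group `G_B = ⋃ₙ G_n`. -/
def fullGroup (B : BratteliDiagram) : Subgroup (B.PathSpace ≃ₜ B.PathSpace) where
  carrier := ⋃ n, (B.levelGroup n : Set (B.PathSpace ≃ₜ B.PathSpace))
  one_mem' := Set.mem_iUnion.2 ⟨0, one_mem _⟩
  mul_mem' {a b} ha hb := by
    obtain ⟨i, hi⟩ := Set.mem_iUnion.1 ha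
    obtain ⟨j, hj⟩ := Set.mem_iUnion.1 hb
    exact Set.mem_iUnion.2 ⟨max i j, mul_mem (B.levelGroup_mono (le_max_left i j) hi)
      (B.levelGroup_mono (le_max_right i j) hj)⟩
  inv_mem' {a} ha := by
    obtain ⟨i, hi⟩ := Set.mem_iUnion.1 ha
    exact Set.mem_iUnion.2 ⟨i, inv_mem (show a ∈ B.levelGroup i from hi)⟩

end BratteliDiagram

/-!
Let `G` be the full group, `P ≤ L(G)` an invariant subalgebra and `E_P : L(G) → P` the
trace-preserving conditional expectation. It suffices that each `E_P(u_g)` is `u_g` or `0`: then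
`P = L(H)` for `H = {g | u_g ∈ P}` (`eq_subgroupVN_of_dichotomy`). Only the vectors
`E_P(u_g) δ_1 ∈ ℓ²(G)` are needed (`expectation`), the components of `δ_g` in the closure of
`P δ_1`; the passage back to operators is `L²(P) ∩ L(G) = P` (`mem_of_apply_delta_one_mem`).

By invariance `E_P(u_g)` commutes with the centralizer of `g` (`expectation_conj`). As an element of
`ℓ²(G)` cannot take a non-zero value infinitely often, `E_P(u_g)` is supported on elements with
finitely many conjugates by the centralizer. For an involution `t` these are only `1` and `t`
(`exists_conj_commute`), and the coefficient at `1` is zero, so `u_t ∈ P` or `E_P(u_t) = 0`.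

* If `u_t ∈ P` for some involution `t`, then `H` is a non-trivial normal subgroup, and
  `u_g* E_P(u_g)` commutes with `u_n` for all `n ∈ H` (`expectation_mul_conj`). Every non-trivial
  element has infinitely many conjugates by `H` (`exists_conj_mem_normal`), because `H` contains the
  commutators of all transpositions inside some small cylinder; so `E_P(u_g)` is a multiple of `u_g`.
* Otherwise no element of `P` has a non-zero coefficient at an involution. Let `p ∈ P` and `h ≠ 1`,
  and let `s` be a transposition inside a cylinder that `h` moves off itself, so that `h⁻¹ s h s` is
  an involution. The coefficient of `p* u_s p u_s*` there is `∑_c conj p̂(c h) p̂(s c s h)`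
  (`inner_conj_eq_zero`), hence this sum vanishes. If the two initial segments exchanged by `s` are
  long and differ only far out, then every `c` in a given finite set commutes with `s` or is moved
  out of the set (`exists_involution`). In the limit the sum is at least `|p̂(h)|²`
  (`apply_one_eq_zero_of_inner_conj`), so `p̂(h) = 0` and `P = ℂ`.

Simplicity of the diagram and infiniteness of the path space enter through
`exists_finset_sameInit_sameTail`: every cylinder contains arbitrarily many paths with a prescribed
tail, and transpositions of their initial segments are the group elements used throughout.
-/

/-! ### Translations of `ℓ²(G)` and the algebra `L(G)` -/

section GroupAlgebra

variable {G : Type*}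

open Classical in
/-- The basis vector `δ_g` of `ℓ²(G)`. -/
noncomputable def delta (g : G) : EllTwo G := lp.single 2 g (1 : ℂ)

theorem delta_apply_self (g : G) : delta g g = 1 := by
  classical simp [delta]

theorem delta_apply_ne {g s : G} (h : s ≠ g) : delta g s = 0 := by
  classical simp [delta, h]

theorem inner_delta_left (g : G) (v : EllTwo G) : inner ℂ (delta g) v = v g := by
  classical simp [delta, lp.inner_single_left]

theorem inner_delta_right (g : G) (v : EllTwo G) :
    inner ℂ v (delta g) = starRingEnd ℂ (v g) := by
  rw [← inner_delta_left, inner_conj_symm]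

theorem memEllTwo_comp_equiv (f : EllTwo G) (e : G ≃ G) : Memℓp (fun s : G => f (e s)) 2 := by
  have h2 : 0 < (2 : ENNReal).toReal := by norm_num
  exact memℓp_gen ((f.2.summable h2).comp_injective e.injective)

/-- The unitary operator on `ℓ²(G)` given by a permutation `e` of `G`:
`(permIso e f)(s) = f (e s)`. -/
noncomputable def permIso (e : G ≃ G) : EllTwo G ≃ₗᵢ[ℂ] EllTwo G where
  toFun f := ⟨fun s => f (e s), memEllTwo_comp_equiv f e⟩
  invFun f := ⟨fun s => f (e.symm s), memEllTwo_comp_equiv f e.symm⟩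
  map_add' f f' := by ext s; rfl
  map_smul' c f := by ext s; rfl
  left_inv f := by ext s; simp
  right_inv f := by ext s; simp
  norm_map' f := by
    have h2 : 0 < (2 : ENNReal).toReal := by norm_num
    rw [lp.norm_eq_tsum_rpow h2, lp.norm_eq_tsum_rpow h2]
    congr 1
    exact e.tsum_eq (fun s : G => ‖f s‖ ^ (2 : ENNReal).toReal)

theorem permIso_apply (e : G ≃ G) (f : EllTwo G) (s : G) : permIso e f s = f (e s) := rfl

theorem permIso_delta (e : G ≃ G) (g : G) : permIso e (delta g) = delta (e.symm g) := by
  ext s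
  rw [permIso_apply]
  by_cases h : e s = g
  · subst h; simp [delta_apply_self]
  · rw [delta_apply_ne h, delta_apply_ne]
    rintro rfl
    simp at h

/-- A function in `ℓ²` takes every non-zero value only finitely often. -/
theorem apply_eq_zero_of_card {v : EllTwo G} {s : G}
    (h : ∀ N : ℕ, ∃ F : Finset G, N ≤ F.card ∧ ∀ t ∈ F, v t = v s) : v s = 0 := by
  by_contra h0
  have h2 : 0 < (2 : ENNReal).toReal := by norm_num
  have hfin : {t : G | v t = v s}.Finite := by
    have := (v.2.summable h2).tendsto_cofinite_zero
    have h3 : 0 < ‖v s‖ ^ (2 : ENNReal).toReal := by positivity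
    have h4 := this.eventually (gt_mem_nhds h3)
    rw [Filter.eventually_cofinite] at h4
    refine h4.subset fun t ht => ?_
    simp only [Set.mem_ofPred_eq] at ht ⊢
    rw [ht]
    exact lt_irrefl _
  obtain ⟨F, hF, hv⟩ := h (hfin.toFinset.card + 1)
  have : F ⊆ hfin.toFinset := fun t ht => by simpa using hv t ht
  have := Finset.card_le_card this
  omega

theorem hasSum_smul_delta (v : EllTwo G) : HasSum (fun s => v s • delta s) v := by
  classical
  have hs (s : G) : lp.single 2 s (v s) = v s • delta s := by
    rw [delta, ← lp.single_smul]
    simp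
  simpa only [hs] using lp.hasSum_single (p := 2) (by norm_num) v

theorem ext_delta {x y : EllTwo G →L[ℂ] EllTwo G} (h : ∀ s, x (delta s) = y (delta s)) :
    x = y := by
  ext1 v
  have hx := (hasSum_smul_delta v).mapL x
  have hy := (hasSum_smul_delta v).mapL y
  simp only [map_smul, h] at hx hy
  exact hx.unique hy

variable [Group G]

theorem leftRegular_apply (g : G) (v : EllTwo G) (s : G) : leftRegular g v s = v (g⁻¹ * s) := rfl

theorem leftRegular_delta (g s : G) : leftRegular g (delta s) = delta (g * s) := by
  classical
  simpa [delta] using leftRegular_single g s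

theorem leftRegular_mul (g h : G) : leftRegular (g * h) = leftRegular g * leftRegular h := by
  ext v s
  simp [leftRegular_apply, mul_assoc]

theorem star_leftRegular (g : G) : star (leftRegular g) = leftRegular g⁻¹ := by
  rw [ContinuousLinearMap.star_eq_adjoint, eq_comm, ContinuousLinearMap.eq_adjoint_iff]
  intro v w
  have h := (leftRegularIso g).inner_map_map ((leftRegular g⁻¹) v) w
  have h' : leftRegularIso g ((leftRegular g⁻¹) v) = v := by
    ext s
    change v (g⁻¹⁻¹ * (g⁻¹ * s)) = v s
    simp
  rw [h'] at h
  exact h.symm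

/-- The right regular representation, `(ρ_g f)(s) = f (s g)`, so that `ρ_g δ_s = δ_{s g⁻¹}`. -/
noncomputable def rightRegular (g : G) : EllTwo G →L[ℂ] EllTwo G :=
  ((permIso (Equiv.mulRight g)).toContinuousLinearEquiv : EllTwo G →L[ℂ] EllTwo G)

theorem rightRegular_apply (g : G) (v : EllTwo G) (s : G) : rightRegular g v s = v (s * g) := rfl

theorem rightRegular_delta (g s : G) : rightRegular g (delta s) = delta (s * g⁻¹) :=
  permIso_delta _ _

theorem rightRegular_commute_leftRegular (g h : G) :
    leftRegular g * rightRegular h = rightRegular h * leftRegular g := by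
  ext v s
  simp [leftRegular_apply, rightRegular_apply, mul_assoc]

theorem mem_vonNeumannGenerated {H : Type*} [NormedAddCommGroup H]
    [InnerProductSpace ℂ H] [CompleteSpace H] {S : Set (H →L[ℂ] H)} {x : H →L[ℂ] H} :
    x ∈ vonNeumannGenerated S ↔ ∀ T : H →L[ℂ] H,
      (∀ y ∈ S, y * T = T * y ∧ star y * T = T * star y) → T * x = x * T := by
  change x ∈ StarSubalgebra.centralizer ℂ
    (StarSubalgebra.centralizer ℂ S : Set (H →L[ℂ] H)) ↔ _
  simp only [StarSubalgebra.mem_centralizer_iff, SetLike.mem_coe]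
  refine ⟨fun h T hT => (h T hT).1, fun h T hT => ⟨h T hT, h _ ?_⟩⟩
  exact (StarSubalgebra.mem_centralizer_iff ℂ).1
    (star_mem ((StarSubalgebra.mem_centralizer_iff ℂ).2 hT))

theorem subset_vonNeumannGenerated {H : Type*} [NormedAddCommGroup H]
    [InnerProductSpace ℂ H] [CompleteSpace H] (S : Set (H →L[ℂ] H)) {x : H →L[ℂ] H} (hx : x ∈ S) :
    x ∈ vonNeumannGenerated S :=
  mem_vonNeumannGenerated.2 fun _ hT => (hT x hx).1.symm

theorem vonNeumannGenerated_le {H : Type*} [NormedAddCommGroup H]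
    [InnerProductSpace ℂ H] [CompleteSpace H] {S : Set (H →L[ℂ] H)} {P : VonNeumannAlgebra H}
    (h : ∀ x ∈ S, x ∈ P) : vonNeumannGenerated S ≤ P := by
  intro x hx
  rw [← P.commutant_commutant, VonNeumannAlgebra.mem_commutant_iff]
  intro T hT
  rw [VonNeumannAlgebra.mem_commutant_iff] at hT
  exact mem_vonNeumannGenerated.1 hx T fun y hy => ⟨hT y (h y hy), hT _ (star_mem (h y hy))⟩

theorem leftRegular_mem_subgroupVN {H : Subgroup G} {h : G} (hh : h ∈ H) :
    leftRegular h ∈ subgroupVN H :=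
  subset_vonNeumannGenerated _ ⟨h, hh, rfl⟩

theorem subgroupVN_le {H : Subgroup G} {P : VonNeumannAlgebra (EllTwo G)}
    (h : ∀ g ∈ H, leftRegular g ∈ P) : subgroupVN H ≤ P := by
  refine vonNeumannGenerated_le ?_
  rintro _ ⟨g, hg, rfl⟩
  exact h g hg

theorem subgroupVN_le_top (H : Subgroup G) : subgroupVN H ≤ subgroupVN (⊤ : Subgroup G) :=
  subgroupVN_le fun _ _ => leftRegular_mem_subgroupVN (Subgroup.mem_top _)

/-- Elements of `L(G)` commute with right translations. -/
theorem apply_rightRegular {x : EllTwo G →L[ℂ] EllTwo G}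
    (hx : x ∈ subgroupVN (⊤ : Subgroup G)) (g : G) (v : EllTwo G) :
    x (rightRegular g v) = rightRegular g (x v) := by
  have h := mem_vonNeumannGenerated.1 hx (rightRegular g) ?_
  · exact (DFunLike.congr_fun h v).symm
  · rintro _ ⟨a, -, rfl⟩
    rw [star_leftRegular]
    exact ⟨rightRegular_commute_leftRegular _ _, rightRegular_commute_leftRegular _ _⟩

theorem apply_delta {x : EllTwo G →L[ℂ] EllTwo G}
    (hx : x ∈ subgroupVN (⊤ : Subgroup G)) (g : G) :
    x (delta g) = rightRegular g⁻¹ (x (delta 1)) := by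
  rw [← apply_rightRegular hx, rightRegular_delta]
  simp

theorem norm_apply_delta {x : EllTwo G →L[ℂ] EllTwo G}
    (hx : x ∈ subgroupVN (⊤ : Subgroup G)) (g : G) : ‖x (delta g)‖ = ‖x (delta 1)‖ := by
  rw [apply_delta hx]
  exact (permIso (Equiv.mulRight g⁻¹)).norm_map _

/-- The vector state at `δ_1` is a trace on `L(G)`: `‖x* δ_1‖ = ‖x δ_1‖`. -/
theorem norm_star_apply_delta_one {x : EllTwo G →L[ℂ] EllTwo G}
    (hx : x ∈ subgroupVN (⊤ : Subgroup G)) : ‖star x (delta 1)‖ = ‖x (delta 1)‖ := by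
  have h2 : 0 < (2 : ENNReal).toReal := by norm_num
  have h (g : G) : ‖star x (delta 1) g‖ = ‖x (delta 1) g⁻¹‖ := by
    rw [← inner_delta_left, ContinuousLinearMap.star_eq_adjoint,
      ContinuousLinearMap.adjoint_inner_right, apply_delta hx, inner_delta_right,
      rightRegular_apply, RCLike.norm_conj, one_mul]
  rw [lp.norm_eq_tsum_rpow h2, lp.norm_eq_tsum_rpow h2]
  simp_rw [h]
  congr 1
  exact (Equiv.inv G).tsum_eq (fun s : G => ‖x (delta 1) s‖ ^ (2 : ENNReal).toReal)

/-- The closed subspace `L²(P)`, the closure of `P δ_1`. -/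
noncomputable def ellTwoClosure (P : VonNeumannAlgebra (EllTwo G)) : Submodule ℂ (EllTwo G) :=
  (Submodule.map (ContinuousLinearMap.apply ℂ (EllTwo G) (delta (1 : G))).toLinearMap
    (Subalgebra.toSubmodule P.toStarSubalgebra.toSubalgebra)).topologicalClosure

theorem apply_delta_one_mem {P : VonNeumannAlgebra (EllTwo G)} {p : EllTwo G →L[ℂ] EllTwo G}
    (hp : p ∈ P) : p (delta 1) ∈ ellTwoClosure P :=
  Submodule.le_topologicalClosure _ ⟨p, hp, rfl⟩

theorem mem_ellTwoClosure {P : VonNeumannAlgebra (EllTwo G)} {v : EllTwo G} :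
    v ∈ ellTwoClosure P ↔ ∀ ε > 0, ∃ p ∈ P, ‖v - p (delta 1)‖ < ε := by
  rw [ellTwoClosure, ← SetLike.mem_coe, Submodule.topologicalClosure_coe, Metric.mem_closure_iff]
  constructor
  · intro h ε hε
    obtain ⟨_, ⟨p, hp, rfl⟩, h⟩ := h ε hε
    exact ⟨p, hp, by simpa [dist_eq_norm] using h⟩
  · intro h ε hε
    obtain ⟨p, hp, h⟩ := h ε hε
    exact ⟨_, ⟨p, hp, rfl⟩, by simpa [dist_eq_norm] using h⟩

instance (P : VonNeumannAlgebra (EllTwo G)) : CompleteSpace (ellTwoClosure P) :=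
  (Submodule.isClosed_topologicalClosure _).completeSpace_coe

/-- `L²(P) ∩ L(G) = P`. For `T` in the commutant of `P` the matrix coefficients of `x T - T x`
do not change when `p ∈ P` is subtracted from `x`, and they are bounded by a multiple of
`‖(x - p) δ_1‖`, because the vector state at `δ_1` is a trace. -/
theorem mem_of_apply_delta_one_mem {P : VonNeumannAlgebra (EllTwo G)}
    (hP : P ≤ subgroupVN (⊤ : Subgroup G)) {x : EllTwo G →L[ℂ] EllTwo G}
    (hx : x ∈ subgroupVN (⊤ : Subgroup G)) (h : x (delta 1) ∈ ellTwoClosure P) : x ∈ P := by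
  rw [← P.commutant_commutant, VonNeumannAlgebra.mem_commutant_iff]
  intro T hT
  rw [VonNeumannAlgebra.mem_commutant_iff] at hT
  refine ext_delta fun s => ?_
  ext t
  rw [← inner_delta_left, ← inner_delta_left, ← sub_eq_zero, ← norm_eq_zero]
  refine le_antisymm (le_of_forall_pos_le_add fun ε hε => ?_) (norm_nonneg _)
  set C := ‖star T (delta t)‖ + ‖T (delta s)‖ with hC
  have hC0 : 0 ≤ C := by positivity
  obtain ⟨p, hp, hpx⟩ := mem_ellTwoClosure.1 h (ε / (C + 1)) (by positivity)
  have hy : x - p ∈ subgroupVN (⊤ : Subgroup G) := sub_mem hx (hP hp)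
  have h0 : inner ℂ (delta t) ((T * x) (delta s)) - inner ℂ (delta t) ((x * T) (delta s)) =
      inner ℂ (star T (delta t)) ((x - p) (delta s)) -
        inner ℂ (star (x - p) (delta t)) (T (delta s)) := by
    rw [ContinuousLinearMap.star_eq_adjoint, ContinuousLinearMap.star_eq_adjoint,
      ContinuousLinearMap.adjoint_inner_left, ContinuousLinearMap.adjoint_inner_left]
    have := DFunLike.congr_fun (hT p hp) (delta s)
    simp only [mul_apply_eq_comp] at this
    simp [inner_sub_right, this]
  have hn : ‖(x - p) (delta 1)‖ ≤ ε / (C + 1) := by simpa using hpx.le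
  have h1 : ‖(x - p) (delta s)‖ ≤ ε / (C + 1) := by rwa [norm_apply_delta hy]
  have h2 : ‖star (x - p) (delta t)‖ ≤ ε / (C + 1) := by
    rwa [norm_apply_delta (star_mem hy), norm_star_apply_delta_one hy]
  rw [h0, zero_add]
  calc _ ≤ ‖star T (delta t)‖ * ‖(x - p) (delta s)‖ +
        ‖star (x - p) (delta t)‖ * ‖T (delta s)‖ :=
      (norm_sub_le _ _).trans (add_le_add (norm_inner_le_norm _ _) (norm_inner_le_norm _ _))
    _ ≤ ‖star T (delta t)‖ * (ε / (C + 1)) + ε / (C + 1) * ‖T (delta s)‖ := by gcongr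
    _ = C * (ε / (C + 1)) := by rw [hC]; ring
    _ ≤ ε := by
      rw [mul_div_assoc', div_le_iff₀ (by positivity)]
      nlinarith

theorem leftRegular_mem_of_delta_mem {P : VonNeumannAlgebra (EllTwo G)}
    (hP : P ≤ subgroupVN (⊤ : Subgroup G)) {g : G} (h : delta g ∈ ellTwoClosure P) :
    leftRegular g ∈ P := by
  refine mem_of_apply_delta_one_mem hP (leftRegular_mem_subgroupVN (Subgroup.mem_top g)) ?_
  rwa [leftRegular_delta, mul_one]

/-! ### Invariant subalgebras -/

/-- The subgroup of all `g` with `u_g ∈ P`; it is normal if `P` is invariant. -/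
noncomputable def translationSubgroup (P : VonNeumannAlgebra (EllTwo G)) : Subgroup G where
  carrier := {g | leftRegular g ∈ P}
  one_mem' := by
    have : leftRegular (1 : G) = 1 := by ext v s; simp [leftRegular_apply]
    simp [this]
  mul_mem' {a b} ha hb := by
    change leftRegular (a * b) ∈ P
    rw [leftRegular_mul]
    exact mul_mem ha hb
  inv_mem' {a} ha := by
    change leftRegular a⁻¹ ∈ P
    rw [← star_leftRegular]
    exact star_mem ha

theorem mem_translationSubgroup {P : VonNeumannAlgebra (EllTwo G)} {g : G} :
    g ∈ translationSubgroup P ↔ leftRegular g ∈ P := Iff.rfl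

theorem IsInvariantVN.conj_mem {P : VonNeumannAlgebra (EllTwo G)} (hP : IsInvariantVN P) (g : G)
    {p : EllTwo G →L[ℂ] EllTwo G} (hp : p ∈ P) :
    leftRegular g * p * leftRegular g⁻¹ ∈ P := by
  have := hP g
  rw [← star_leftRegular, ← SetLike.mem_coe, ← this]
  exact ⟨p, hp, rfl⟩

theorem IsInvariantVN.normal_translationSubgroup {P : VonNeumannAlgebra (EllTwo G)}
    (hP : IsInvariantVN P) : (translationSubgroup P).Normal := by
  refine ⟨fun n hn g => ?_⟩
  rw [mem_translationSubgroup, leftRegular_mul, leftRegular_mul]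
  exact hP.conj_mem g hn

/-- If every `g` satisfies `u_g ∈ P` or has vanishing coefficient on `P`, then `P = L(H)` for
`H = {g | u_g ∈ P}`. -/
theorem eq_subgroupVN_of_dichotomy {P : VonNeumannAlgebra (EllTwo G)}
    (hP : P ≤ subgroupVN (⊤ : Subgroup G))
    (h : ∀ g : G, leftRegular g ∈ P ∨ ∀ p ∈ P, p (delta 1) g = 0) :
    P = subgroupVN (translationSubgroup P) := by
  refine le_antisymm (fun p hp => ?_) (subgroupVN_le fun g hg => hg)
  refine mem_of_apply_delta_one_mem (subgroupVN_le_top _) (hP hp) ?_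
  refine (Submodule.isClosed_topologicalClosure _).mem_of_tendsto (hasSum_smul_delta _)
    (Filter.Eventually.of_forall fun F => Submodule.sum_mem _ fun g _ => ?_)
  rcases h g with hg | hg
  · refine Submodule.smul_mem _ _ ?_
    have := apply_delta_one_mem (leftRegular_mem_subgroupVN (mem_translationSubgroup.2 hg))
    rwa [leftRegular_delta, mul_one] at this
  · rw [hg p hp, zero_smul]
    exact zero_mem _

/-- The component of `δ_g` in `L²(P)`, that is, `E_P(u_g) δ_1` for the trace-preserving
conditional expectation `E_P : L(G) → P`. -/
noncomputable def expectation (P : VonNeumannAlgebra (EllTwo G)) (g : G) : EllTwo G :=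
  (ellTwoClosure P).starProjection (delta g)

theorem inner_expectation {P : VonNeumannAlgebra (EllTwo G)} (g : G) {v : EllTwo G}
    (hv : v ∈ ellTwoClosure P) : inner ℂ (expectation P g) v = v g := by
  rw [expectation, Submodule.inner_starProjection_left_eq_right,
    Submodule.starProjection_eq_self_iff.2 hv, inner_delta_left]

theorem expectation_mem (P : VonNeumannAlgebra (EllTwo G)) (g : G) :
    expectation P g ∈ ellTwoClosure P :=
  Submodule.starProjection_apply_mem _ _

/-- A unitary operator that fixes `δ_g` and maps `L²(P)` to itself, as does its adjoint, fixes the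
component of `δ_g` in `L²(P)`. -/
theorem map_expectation {P : VonNeumannAlgebra (EllTwo G)} {g : G}
    (U : EllTwo G ≃ₗᵢ[ℂ] EllTwo G) (hg : U (delta g) = delta g)
    (h1 : ∀ p ∈ P, U (p (delta 1)) ∈ ellTwoClosure P)
    (h2 : ∀ p ∈ P, U.symm (p (delta 1)) ∈ ellTwoClosure P) :
    U (expectation P g) = expectation P g := by
  have key (W : EllTwo G ≃ₗᵢ[ℂ] EllTwo G) (hW : ∀ p ∈ P, W (p (delta 1)) ∈ ellTwoClosure P)
      (v : EllTwo G) (hv : v ∈ ellTwoClosure P) : W v ∈ ellTwoClosure P := by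
    refine Submodule.topologicalClosure_minimal (t := (ellTwoClosure P).comap
      (W.toContinuousLinearEquiv : EllTwo G →L[ℂ] EllTwo G).toLinearMap) _ ?_ ?_ hv
    · rintro _ ⟨p, hp, rfl⟩
      exact hW p hp
    · exact (Submodule.isClosed_topologicalClosure _).preimage W.continuous
  refine (Submodule.eq_starProjection_of_mem_of_inner_eq_zero (key U h1 _ (expectation_mem P g))
    fun w hw => ?_).symm
  have h3 := key U.symm h2 w hw
  have h4 := Submodule.starProjection_inner_eq_zero (K := ellTwoClosure P) (delta g) _ h3
  rw [← U.inner_map_map, map_sub, hg, U.apply_symm_apply] at h4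
  exact h4

/-- `map_expectation` for the unitary operator `δ_s ↦ δ_{a s b⁻¹}`, read off in coefficients. -/
theorem expectation_apply_mul_mul {P : VonNeumannAlgebra (EllTwo G)} {g a b : G}
    (hg : a * g * b⁻¹ = g)
    (h1 : ∀ p ∈ P, rightRegular b (leftRegular a (p (delta 1))) ∈ ellTwoClosure P)
    (h2 : ∀ p ∈ P, rightRegular b⁻¹ (leftRegular a⁻¹ (p (delta 1))) ∈ ellTwoClosure P) (s : G) :
    expectation P g (a * s * b⁻¹) = expectation P g s := by
  let e : G ≃ G := (Equiv.mulLeft a).trans (Equiv.mulRight b⁻¹)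
  have := map_expectation (P := P) (g := g) (permIso e) ?_ ?_ ?_
  · exact congrFun (congrArg (fun v : EllTwo G => (v : G → ℂ)) this) s
  · rw [permIso_delta]
    congr 1
    rw [Equiv.symm_apply_eq]
    exact hg.symm
  · intro p hp
    convert h2 p hp using 1
    ext s
    simp [e, permIso_apply, rightRegular_apply, leftRegular_apply, mul_assoc]
  · intro p hp
    convert h1 p hp using 1
    ext s
    change p (delta 1) (a⁻¹ * (s * b⁻¹⁻¹)) = p (delta 1) (a⁻¹ * (s * b))
    simp

/-- `E_P(u_g)` is fixed under conjugation by the centralizer of `g`. -/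
theorem expectation_conj {P : VonNeumannAlgebra (EllTwo G)}
    (hP : P ≤ subgroupVN (⊤ : Subgroup G)) (hinv : IsInvariantVN P) {g k : G}
    (hk : Commute k g) (s : G) : expectation P g (k * s * k⁻¹) = expectation P g s := by
  have key (k : G) : ∀ p ∈ P, rightRegular k (leftRegular k (p (delta 1))) ∈ ellTwoClosure P := by
    intro p hp
    have := apply_delta_one_mem (hinv.conj_mem k hp)
    convert this using 1
    rw [mul_apply_eq_comp, leftRegular_delta, mul_one, mul_apply_eq_comp,
      apply_delta (hP hp) k⁻¹, inv_inv]
    exact DFunLike.congr_fun (rightRegular_commute_leftRegular k k).symm _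
  refine expectation_apply_mul_mul ?_ (key k) (key k⁻¹) s
  rw [hk.eq, mul_inv_cancel_right]

/-- `u_g* E_P(u_g)` is fixed under conjugation by the `n` with `u_n ∈ P`. -/
theorem expectation_mul_conj {P : VonNeumannAlgebra (EllTwo G)}
    (hP : P ≤ subgroupVN (⊤ : Subgroup G)) (hinv : IsInvariantVN P) {g n : G}
    (hn : n ∈ translationSubgroup P) (s : G) :
    expectation P g (g * (n * s * n⁻¹)) = expectation P g (g * s) := by
  have key {a b : G} (ha : a ∈ translationSubgroup P) (hb : b ∈ translationSubgroup P) :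
      ∀ p ∈ P, rightRegular b (leftRegular a (p (delta 1))) ∈ ellTwoClosure P := by
    intro p hp
    have := apply_delta_one_mem (mul_mem (mul_mem ha hp) (inv_mem hb : b⁻¹ ∈ translationSubgroup P))
    convert this using 1
    rw [mul_apply_eq_comp, leftRegular_delta, mul_one, mul_apply_eq_comp,
      apply_delta (hP hp) b⁻¹, inv_inv]
    exact DFunLike.congr_fun (rightRegular_commute_leftRegular a b).symm _
  have hn' : g * n * g⁻¹ ∈ translationSubgroup P := hinv.normal_translationSubgroup.conj_mem n hn g
  have := expectation_apply_mul_mul (g := g) (a := g * n * g⁻¹) (b := n) (by group) (key hn' hn)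
    (key (inv_mem hn') (inv_mem hn)) (g * s)
  rw [← this]
  group

/-- If `E_P(u_g)` is a multiple of `u_g`, then `u_g ∈ P` or `E_P(u_g) = 0`. -/
theorem mem_or_coeff_eq_zero {P : VonNeumannAlgebra (EllTwo G)}
    (hP : P ≤ subgroupVN (⊤ : Subgroup G)) {g : G} (h : ∀ s, s ≠ g → expectation P g s = 0) :
    leftRegular g ∈ P ∨ ∀ p ∈ P, p (delta 1) g = 0 := by
  have h1 : expectation P g = expectation P g g • delta g := by
    ext s
    by_cases hs : s = g
    · subst hs; simp [delta_apply_self]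
    · simp [h s hs, delta_apply_ne hs]
  by_cases hc : expectation P g g = 0
  · right
    intro p hp
    rw [← inner_expectation g (apply_delta_one_mem hp), h1, hc]
    simp
  · left
    refine leftRegular_mem_of_delta_mem hP ?_
    have h2 := expectation_mem P g
    rw [h1] at h2
    exact (Submodule.smul_mem_iff _ hc).1 h2

end GroupAlgebra

/-! ### Vanishing coefficients -/

section Vanishing

variable {G : Type*} [Group G]

/-- Suppose that for every finite set `F` there is an `s` such that `v ∈ ℓ²(G)` is orthogonal to its
conjugate by `s`, and conjugation by `s` either fixes an element of `F` or maps it out of `F`. Then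
`v 1 = 0`: the inner product for the truncation of `v` to a large `F` is a sum of terms `|v c|²`,
one of which is `|v 1|²`, and it is close to the inner product for `v`, which is zero. -/
theorem apply_one_eq_zero_of_inner_conj {v : EllTwo G}
    (h : ∀ F : Finset G, ∃ s : G, (∀ c ∈ F, s * c * s⁻¹ ∈ F → s * c * s⁻¹ = c) ∧
      inner ℂ v (permIso (MulAut.conj s).toEquiv v) = 0) : v 1 = 0 := by
  classical
  have hbound : ∀ ε : ℝ, 0 < ε → ε ≤ 1 → ‖v 1‖ ^ 2 ≤ ε * (2 * ‖v‖ + 1) := by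
    intro ε hε hε1
    have htend := Metric.tendsto_nhds.1 (hasSum_smul_delta v) ε hε
    obtain ⟨F, hF1, hF⟩ := (htend.and (Filter.eventually_ge_atTop {1})).exists
    obtain ⟨s, hs, hinner⟩ := h F
    set w : EllTwo G := ∑ c ∈ F, v c • delta c with hw
    set U := permIso (MulAut.conj s).toEquiv with hU
    have hd : ‖v - w‖ ≤ ε := by rw [← dist_eq_norm, dist_comm]; exact hF1.le
    have hwn : ‖w‖ ≤ ‖v‖ + 1 := by
      have : ‖w‖ ≤ ‖v‖ + ‖w - v‖ := by simpa using norm_add_le v (w - v)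
      rw [norm_sub_rev] at this
      linarith
    have hwi (x : G) : w x = if x ∈ F then v x else 0 := by
      rw [← inner_delta_left, hw, inner_sum]
      simp_rw [inner_smul_right, inner_delta_left]
      split_ifs with hx
      · rw [Finset.sum_eq_single x]
        · simp [delta_apply_self]
        · intro c _ hc
          simp [delta_apply_ne hc.symm]
        · exact fun h => absurd hx h
      · refine Finset.sum_eq_zero fun c hc => ?_
        rw [delta_apply_ne (by rintro rfl; exact hx hc), mul_zero]
    have hUw : inner ℂ w (U w) = ∑ c ∈ F, starRingEnd ℂ (v c) * w (s * c * s⁻¹) := by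
      conv_lhs => rw [hw, sum_inner]
      refine Finset.sum_congr rfl fun c _ => ?_
      rw [inner_smul_left, inner_delta_left]
      rfl
    have hlow : ‖v 1‖ ^ 2 ≤ (inner ℂ w (U w)).re := by
      have hterm (c : G) (hc : c ∈ F) : 0 ≤ (starRingEnd ℂ (v c) * w (s * c * s⁻¹)).re := by
        rw [hwi]
        split_ifs with hx
        · rw [hs c hc hx, Complex.conj_mul']
          norm_cast
          positivity
        · simp
      rw [hUw, Complex.re_sum]
      have h1 : (1 : G) ∈ F := hF (Finset.mem_singleton_self 1)
      refine le_trans (le_of_eq ?_) (Finset.single_le_sum hterm h1)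
      rw [mul_one, mul_inv_cancel, hwi, if_pos h1, Complex.conj_mul']
      norm_cast
    have hsplit : inner ℂ w (U w) = - (inner ℂ (v - w) (U v) + inner ℂ w (U (v - w))) := by
      rw [inner_sub_left, map_sub, inner_sub_right, hinner]
      ring
    calc ‖v 1‖ ^ 2 ≤ ‖inner ℂ w (U w)‖ := hlow.trans (Complex.re_le_norm _)
      _ ≤ ‖v - w‖ * ‖U v‖ + ‖w‖ * ‖U (v - w)‖ := by
        rw [hsplit, norm_neg]
        exact (norm_add_le _ _).trans
          (add_le_add (norm_inner_le_norm _ _) (norm_inner_le_norm _ _))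
      _ = ‖v - w‖ * (‖v‖ + ‖w‖) := by rw [U.norm_map, U.norm_map]; ring
      _ ≤ ε * (2 * ‖v‖ + 1) := by
        exact mul_le_mul hd (by linarith) (by positivity) hε.le
  by_contra h0
  have hpos : 0 < ‖v 1‖ ^ 2 := by positivity
  have hC : 0 < 2 * (2 * ‖v‖ + 1) := by positivity
  have := hbound (min 1 (‖v 1‖ ^ 2 / (2 * (2 * ‖v‖ + 1)))) (by positivity) (min_le_left _ _)
  have h2 : min 1 (‖v 1‖ ^ 2 / (2 * (2 * ‖v‖ + 1))) * (2 * ‖v‖ + 1) ≤ ‖v 1‖ ^ 2 / 2 := by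
    calc _ ≤ ‖v 1‖ ^ 2 / (2 * (2 * ‖v‖ + 1)) * (2 * ‖v‖ + 1) := by
          gcongr
          exact min_le_right _ _
      _ = _ := by field_simp
  linarith

/-- The coefficient of `p* u_s p u_s*` at `h⁻¹ s h s`, for an involution `s`, is the inner product
of `c ↦ p̂(c h)` with its conjugate by `s`. -/
theorem inner_conj_eq_zero {P : VonNeumannAlgebra (EllTwo G)}
    (hP : P ≤ subgroupVN (⊤ : Subgroup G)) (hinv : IsInvariantVN P) {s h : G} (hs : s * s = 1)
    (ht : ∀ p ∈ P, p (delta 1) (h⁻¹ * s * h * s) = 0) {p : EllTwo G →L[ℂ] EllTwo G}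
    (hp : p ∈ P) :
    inner ℂ (rightRegular h (p (delta 1)))
      (permIso (MulAut.conj s).toEquiv (rightRegular h (p (delta 1)))) = 0 := by
  have hs' : s⁻¹ = s := inv_eq_of_mul_eq_one_left hs
  have hss (x : G) : s * (s * x) = x := by rw [← mul_assoc, hs, one_mul]
  have h0 := ht _ (mul_mem (star_mem hp) (hinv.conj_mem s hp))
  rw [← inner_delta_left, mul_apply_eq_comp, ContinuousLinearMap.star_eq_adjoint,
    ContinuousLinearMap.adjoint_inner_right, mul_apply_eq_comp, leftRegular_delta, mul_one,
    mul_apply_eq_comp, apply_delta (hP hp), apply_delta (hP hp) s⁻¹] at h0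
  -- the substitution `g = c s h s` in the sum over `g`
  rw [← (permIso (Equiv.mulRight (s * h * s))).inner_map_map] at h0
  rw [← h0]
  congr 1
  · ext c
    simp only [permIso_apply, rightRegular_apply, Equiv.coe_mulRight]
    simp [mul_assoc, hs', hss]
  · ext c
    simp only [permIso_apply, rightRegular_apply, leftRegular_apply, Equiv.coe_mulRight]
    simp [mul_assoc, hs', hs]

end Vanishing

namespace BratteliDiagram

variable {B : BratteliDiagram}

/-! ### Paths with a common initial segment or a common tail -/

/-- The paths `x` and `y` have the same initial segment of length `n`. -/
def SameInit (n : ℕ) (x y : B.PathSpace) : Prop := ∀ k, k < n → x.1 k = y.1 k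

/-- The paths `x` and `y` agree after their first `n` edges. -/
def SameTail (n : ℕ) (x y : B.PathSpace) : Prop := ∀ k, n ≤ k → x.1 k = y.1 k

theorem SameInit.refl (n : ℕ) (x : B.PathSpace) : SameInit n x x := fun _ _ => rfl

theorem SameInit.symm {n : ℕ} {x y : B.PathSpace} (h : SameInit n x y) : SameInit n y x :=
  fun k hk => (h k hk).symm

theorem SameInit.trans {n : ℕ} {x y z : B.PathSpace} (h : SameInit n x y) (h' : SameInit n y z) :
    SameInit n x z := fun k hk => (h k hk).trans (h' k hk)

theorem SameInit.mono {m n : ℕ} {x y : B.PathSpace} (h : SameInit n x y) (hmn : m ≤ n) :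
    SameInit m x y := fun k hk => h k (hk.trans_le hmn)

theorem SameTail.refl (n : ℕ) (x : B.PathSpace) : SameTail n x x := fun _ _ => rfl

theorem SameTail.symm {n : ℕ} {x y : B.PathSpace} (h : SameTail n x y) : SameTail n y x :=
  fun k hk => (h k hk).symm

theorem SameTail.trans {n : ℕ} {x y z : B.PathSpace} (h : SameTail n x y) (h' : SameTail n y z) :
    SameTail n x z := fun k hk => (h k hk).trans (h' k hk)

theorem SameTail.mono {m n : ℕ} {x y : B.PathSpace} (h : SameTail m x y) (hmn : m ≤ n) :
    SameTail n x y := fun k hk => h k (hmn.trans hk)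

theorem eq_of_sameInit_of_sameTail {n : ℕ} {x y : B.PathSpace} (h : SameInit n x y)
    (h' : SameTail n x y) : x = y :=
  Subtype.ext (funext fun k => (lt_or_ge k n).elim (h k) (h' k))

/-- The vertex at level `n` of a path is determined by its initial segment of length `n`. -/
theorem SameInit.source_eq {n : ℕ} {x y : B.PathSpace} (h : SameInit n x y) :
    B.s (x.1 n) = B.s (y.1 n) := by
  cases n with
  | zero => rw [B.eq_root (B.s (x.1 0)), B.eq_root (B.s (y.1 0))]
  | succ n => rw [x.2, y.2, h n (Nat.lt_succ_self n)]

open Classical in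
/-- `splice m y z` follows `y` for the first `m` edges and `z` afterwards, if `y` and `z` pass
through the same vertex at level `m`; otherwise its value is `z` by convention. -/
noncomputable def splice (m : ℕ) (y z : B.PathSpace) : B.PathSpace :=
  if h : B.s (y.1 m) = B.s (z.1 m) then
    ⟨fun k => if k < m then y.1 k else z.1 k, fun k => by
      dsimp only
      rcases lt_trichotomy (k + 1) m with hk | hk | hk
      · rw [if_pos hk, if_pos (by omega)]
        exact y.2 k
      · subst hk
        rw [if_neg (by omega), if_pos (by omega), ← h]
        exact y.2 k
      · rw [if_neg (by omega), if_neg (by omega)]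
        exact z.2 k⟩
  else z

theorem sameInit_splice {m : ℕ} {y z : B.PathSpace} (h : B.s (y.1 m) = B.s (z.1 m)) :
    SameInit m (splice m y z) y := by
  intro k hk
  simp [splice, h, hk]

theorem sameTail_splice (m : ℕ) (y z : B.PathSpace) : SameTail m (splice m y z) z := by
  intro k hk
  by_cases h : B.s (y.1 m) = B.s (z.1 m)
  · simp [splice, h, hk.not_gt]
  · simp [splice, h]

/-- Two vertices that are joined by a path of edges are joined by a piece of an infinite path
whose beginning and end can be prescribed. -/
theorem exists_finite_path {n : ℕ} {v : B.V n} {m : ℕ} {w : B.V m} (h : B.Connected v w)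
    (x : B.PathSpace) (hx : B.s (x.1 n) = v) :
    n ≤ m ∧ ∀ e' : B.E m, B.s e' = w → ∃ y : ∀ k, B.E k,
      (∀ k, k < n → y k = x.1 k) ∧ y m = e' ∧ ∀ k, k < m → B.s (y (k + 1)) = B.r (y k) := by
  induction h with
  | refl =>
    refine ⟨le_rfl, fun e' he' => ⟨Function.update x.1 n e', fun k hk => ?_, ?_, fun k hk => ?_⟩⟩
    · rw [Function.update_of_ne hk.ne]
    · rw [Function.update_self]
    · rw [Function.update_of_ne hk.ne]
      rcases (Nat.succ_le_of_lt hk).lt_or_eq with hk' | hk'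
      · rw [Function.update_of_ne hk'.ne]
        exact x.2 k
      · subst hk'
        rw [Function.update_self, he', ← hx]
        exact x.2 k
  | @step m e _ ih =>
    obtain ⟨hnm, ih⟩ := ih
    refine ⟨hnm.trans (Nat.le_succ m), fun e' he' => ?_⟩
    obtain ⟨y, hyx, hye, hy⟩ := ih e rfl
    refine ⟨Function.update y (m + 1) e', fun k hk => ?_, ?_, fun k hk => ?_⟩
    · rw [Function.update_of_ne (by omega), hyx k hk]
    · rw [Function.update_self]
    · rw [Function.update_of_ne hk.ne]
      rcases (Nat.succ_le_of_lt hk).lt_or_eq with hk' | hk'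
      · rw [Function.update_of_ne hk'.ne]
        exact hy k (by omega)
      · obtain rfl : k = m := by omega
        rw [Function.update_self, he', hye]

theorem exists_path_of_connected {n m : ℕ} {x z : B.PathSpace}
    (h : B.Connected (B.s (x.1 n)) (B.s (z.1 m))) :
    ∃ y : B.PathSpace, SameInit n y x ∧ SameTail m y z := by
  obtain ⟨hnm, h⟩ := exists_finite_path h x rfl
  obtain ⟨y, hyx, hyz, hy⟩ := h (z.1 m) rfl
  refine ⟨⟨fun k => if k < m then y k else z.1 k, fun k => ?_⟩, fun k hk => ?_, fun k hk => ?_⟩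
  · dsimp only
    rcases lt_trichotomy (k + 1) m with hk | hk | hk
    · rw [if_pos hk, if_pos (by omega)]
      exact hy k (by omega)
    · subst hk
      rw [if_neg (by omega), if_pos (by omega), ← hyz]
      exact hy k (by omega)
    · rw [if_neg (by omega), if_neg (by omega)]
      exact z.2 k
  · simp only [if_pos (hk.trans_le hnm)]
    exact hyx k hk
  · simp only [if_neg (Nat.not_lt.2 hk)]

theorem exists_sameInit_sameTail (hB : B.IsSimple) (n : ℕ) :
    ∃ m, n ≤ m ∧ ∀ x z : B.PathSpace, ∃ y, SameInit n y x ∧ SameTail m y z := by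
  obtain ⟨m, hm, h⟩ := hB (max n 1) (le_max_right _ _)
  refine ⟨m, (le_max_left _ _).trans hm.le, fun x z => ?_⟩
  obtain ⟨y, hy, hy'⟩ := exists_path_of_connected (x := x) (z := z) (h _ _)
  exact ⟨y, hy.mono (le_max_left _ _), hy'⟩

theorem exists_ne_edge (hX : Infinite B.PathSpace) (n : ℕ) :
    ∃ k, n ≤ k ∧ ∃ p q : B.PathSpace, p.1 k ≠ q.1 k := by
  by_contra! h
  have hE := B.finite_E
  have : Function.Injective fun (x : B.PathSpace) (i : Fin n) => x.1 i := by
    intro x y hxy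
    exact eq_of_sameInit_of_sameTail (n := n) (fun k hk => congrFun hxy ⟨k, hk⟩)
      fun k hk => h k hk x y
  exact hX.not_finite (Finite.of_injective _ this)

theorem exists_two_sameInit_sameTail (hB : B.IsSimple) (hX : Infinite B.PathSpace) (n : ℕ) :
    ∃ m, n ≤ m ∧ ∀ x z : B.PathSpace, ∃ y y', y ≠ y' ∧ (SameInit n y x ∧ SameTail m y z) ∧
      SameInit n y' x ∧ SameTail m y' z := by
  obtain ⟨m₁, hm₁, h₁⟩ := exists_sameInit_sameTail hB n
  obtain ⟨k, hk, p, q, hpq⟩ := exists_ne_edge hX m₁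
  obtain ⟨m₂, hm₂, h₂⟩ := exists_sameInit_sameTail hB (k + 1)
  refine ⟨m₂, by omega, fun x z => ?_⟩
  have key (p : B.PathSpace) : ∃ y, y.1 k = p.1 k ∧ SameInit n y x ∧ SameTail m₂ y z := by
    obtain ⟨y₁, hy₁, hy₁'⟩ := h₁ x p
    obtain ⟨y₂, hy₂, hy₂'⟩ := h₂ y₁ z
    exact ⟨y₂, (hy₂ k (Nat.lt_succ_self k)).trans (hy₁' k hk),
      (hy₂.mono (by omega)).trans hy₁, hy₂'⟩
  obtain ⟨y, hy, h⟩ := key p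
  obtain ⟨y', hy', h'⟩ := key q
  exact ⟨y, y', fun e => hpq (by rw [← hy, ← hy', e]), h, h'⟩

/-- In a simple diagram with infinitely many paths, the number of paths from a vertex at level `n`
to a vertex at level `m` tends to infinity with `m`, uniformly in the vertices (along a sequence
of levels). -/
theorem exists_finset_sameInit_sameTail (hB : B.IsSimple) (hX : Infinite B.PathSpace)
    (n N : ℕ) :
    ∃ m, n ≤ m ∧ ∀ x z : B.PathSpace, ∃ S : Finset B.PathSpace, N ≤ S.card ∧
      ∀ y ∈ S, SameInit n y x ∧ SameTail m y z := by
  classical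
  induction N with
  | zero => exact ⟨n, le_rfl, fun _ _ => ⟨∅, by simp⟩⟩
  | succ N ih =>
    obtain ⟨m, hm, h⟩ := ih
    obtain ⟨m', hm', h'⟩ := exists_two_sameInit_sameTail hB hX m
    refine ⟨m', hm.trans hm', fun x z => ?_⟩
    obtain ⟨y, y', hne, ⟨hyx, hyz⟩, hyx', hyz'⟩ := h' x z
    obtain ⟨S, hS, hSy⟩ := h x y
    refine ⟨insert y' S, ?_, fun u hu => ?_⟩
    · rw [Finset.card_insert_of_notMem]
      · omega
      · intro hy'
        exact hne (eq_of_sameInit_of_sameTail (hyx.trans hyx'.symm) (hSy y' hy').2.symm)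
    · rcases Finset.mem_insert.1 hu with rfl | hu
      · exact ⟨hyx'.mono hm, hyz'⟩
      · exact ⟨(hSy u hu).1, ((hSy u hu).2.mono hm').trans hyz⟩

/-! ### Transpositions of initial segments -/

open Classical in
/-- Exchange the initial segments of length `m` of the paths `x` and `y`. -/
noncomputable def swapFun (m : ℕ) (x y z : B.PathSpace) : B.PathSpace :=
  if SameInit m z x then splice m y z else if SameInit m z y then splice m x z else z

theorem swapFun_left {m : ℕ} {x y z : B.PathSpace} (h : SameInit m z x) :
    swapFun m x y z = splice m y z := if_pos h

theorem swapFun_of_not {m : ℕ} {x y z : B.PathSpace} (h : ¬ SameInit m z x)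
    (h' : ¬ SameInit m z y) : swapFun m x y z = z := by
  rw [swapFun, if_neg h, if_neg h']

theorem swapFun_right {m : ℕ} {x y z : B.PathSpace} (hxy : SameTail m x y)
    (h : SameInit m z y) : swapFun m x y z = splice m x z := by
  by_cases h' : SameInit m z x
  · rw [swapFun_left h', eq_of_sameInit_of_sameTail (h'.symm.trans h) hxy]
  · rw [swapFun, if_neg h', if_pos h]

theorem sameTail_swapFun (m : ℕ) (x y z : B.PathSpace) : SameTail m (swapFun m x y z) z := by
  unfold swapFun
  split_ifs
  · exact sameTail_splice _ _ _
  · exact sameTail_splice _ _ _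
  · exact SameTail.refl _ _

theorem sameInit_swapFun_left {m : ℕ} {x y z : B.PathSpace} (hxy : SameTail m x y)
    (h : SameInit m z x) : SameInit m (swapFun m x y z) y := by
  rw [swapFun_left h]
  exact sameInit_splice (by rw [h.source_eq, hxy m le_rfl])

theorem sameInit_swapFun_right {m : ℕ} {x y z : B.PathSpace} (hxy : SameTail m x y)
    (h : SameInit m z y) : SameInit m (swapFun m x y z) x := by
  rw [swapFun_right hxy h]
  exact sameInit_splice (by rw [h.source_eq, hxy m le_rfl])

theorem swapFun_swapFun {m : ℕ} {x y : B.PathSpace} (hxy : SameTail m x y) (z : B.PathSpace) :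
    swapFun m x y (swapFun m x y z) = z := by
  refine eq_of_sameInit_of_sameTail (n := m) ?_
    ((sameTail_swapFun m x y _).trans (sameTail_swapFun m x y z))
  by_cases h : SameInit m z x
  · exact (sameInit_swapFun_right hxy (sameInit_swapFun_left hxy h)).trans h.symm
  by_cases h' : SameInit m z y
  · exact (sameInit_swapFun_left hxy (sameInit_swapFun_right hxy h')).trans h'.symm
  rw [swapFun_of_not h h', swapFun_of_not h h']
  exact SameInit.refl _ _

theorem sameInit_swapFun {m : ℕ} {x y : B.PathSpace} (hxy : SameTail m x y) {z w : B.PathSpace}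
    (hzw : SameInit m z w) : SameInit m (swapFun m x y z) (swapFun m x y w) := by
  by_cases h : SameInit m z x
  · exact (sameInit_swapFun_left hxy h).trans
      (sameInit_swapFun_left hxy (hzw.symm.trans h)).symm
  by_cases h' : SameInit m z y
  · exact (sameInit_swapFun_right hxy h').trans
      (sameInit_swapFun_right hxy (hzw.symm.trans h')).symm
  rw [swapFun_of_not h h', swapFun_of_not (fun e => h (hzw.trans e)) fun e => h' (hzw.trans e)]
  exact hzw

theorem continuous_of_sameInit {f : B.PathSpace → B.PathSpace} {m : ℕ}
    (h : ∀ k, m ≤ k → ∀ z w, SameInit k z w → SameInit k (f z) (f w)) : Continuous f := by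
  have h0 (k : ℕ) : Continuous fun z : B.PathSpace => z.1 k :=
    (continuous_apply k).comp continuous_subtype_val
  refine Continuous.subtype_mk (continuous_pi fun k => ?_) _
  rw [continuous_iff_continuousAt]
  intro z
  refine continuousAt_const.congr (f := fun _ => (f z).1 k) ?_
  have hopen : IsOpen {w : B.PathSpace | SameInit (max m (k + 1)) z w} := by
    have : {w : B.PathSpace | SameInit (max m (k + 1)) z w} =
        ⋂ i ∈ Finset.range (max m (k + 1)), (fun w : B.PathSpace => w.1 i) ⁻¹' {z.1 i} := by
      ext w
      simp [SameInit, eq_comm]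
    rw [this]
    exact isOpen_biInter_finset fun i _ => (isOpen_discrete _).preimage (h0 i)
  filter_upwards [hopen.mem_nhds (SameInit.refl _ z)] with w hw
  exact h _ (le_max_left _ _) z w hw k ((Nat.lt_succ_self k).trans_le (le_max_right _ _))

theorem continuous_swapFun {m : ℕ} {x y : B.PathSpace} (hxy : SameTail m x y) :
    Continuous (swapFun m x y) := by
  refine continuous_of_sameInit (m := m) fun k hk z w hzw j hj => ?_
  rcases lt_or_ge j m with h | h
  · exact sameInit_swapFun hxy (hzw.mono hk) j h
  · rw [sameTail_swapFun m x y z j h, sameTail_swapFun m x y w j h, hzw j hj]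

/-- `swapFun` as a homeomorphism. -/
noncomputable def swapHomeo {m : ℕ} {x y : B.PathSpace} (hxy : SameTail m x y) :
    B.PathSpace ≃ₜ B.PathSpace where
  toFun := swapFun m x y
  invFun := swapFun m x y
  left_inv := swapFun_swapFun hxy
  right_inv := swapFun_swapFun hxy
  continuous_toFun := continuous_swapFun hxy
  continuous_invFun := continuous_swapFun hxy

theorem swapHomeo_mem {m : ℕ} {x y : B.PathSpace} (hxy : SameTail m x y) :
    swapHomeo hxy ∈ B.levelGroup m := by
  refine ⟨sameTail_swapFun m x y, fun z w => ⟨fun h => ?_, sameInit_swapFun hxy⟩⟩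
  have := sameInit_swapFun hxy h
  change SameInit m (swapFun m x y (swapFun m x y z)) (swapFun m x y (swapFun m x y w)) at this
  rwa [swapFun_swapFun hxy, swapFun_swapFun hxy] at this

/-! ### The action of the full group on the path space -/

instance : MulAction B.fullGroup B.PathSpace where
  smul g x := g.1 x
  one_smul _ := rfl
  mul_smul _ _ _ := rfl

theorem fullGroup_ext {g h : B.fullGroup} (H : ∀ x : B.PathSpace, g • x = h • x) : g = h :=
  Subtype.ext (Homeomorph.ext H)

/-- The subgroup `G_n` of `G_B`. -/
def level (B : BratteliDiagram) (n : ℕ) : Subgroup B.fullGroup :=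
  (B.levelGroup n).subgroupOf B.fullGroup

theorem level_mono {m n : ℕ} (h : m ≤ n) : B.level m ≤ B.level n :=
  fun _ hg => B.levelGroup_mono h hg

theorem exists_mem_level (g : B.fullGroup) : ∃ n, g ∈ B.level n := by
  obtain ⟨n, hn⟩ := Set.mem_iUnion.1 g.2
  exact ⟨n, hn⟩

theorem exists_forall_mem_level (F : Finset B.fullGroup) : ∃ n, ∀ g ∈ F, g ∈ B.level n := by
  choose l hl using exists_mem_level (B := B)
  exact ⟨F.sup l, fun g hg => level_mono (Finset.le_sup hg) (hl g)⟩

theorem sameTail_smul {n : ℕ} {g : B.fullGroup} (hg : g ∈ B.level n) (x : B.PathSpace) :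
    SameTail n (g • x) x := hg.1 x

theorem sameInit_smul_iff {n : ℕ} {g : B.fullGroup} (hg : g ∈ B.level n) {x y : B.PathSpace} :
    SameInit n (g • x) (g • y) ↔ SameInit n x y := hg.2 x y

/-- An element of `G_n` that fixes `x` fixes the whole cylinder of length `n` around `x`. -/
theorem smul_eq_of_sameInit {n : ℕ} {g : B.fullGroup} (hg : g ∈ B.level n) {x y : B.PathSpace}
    (h : SameInit n y x) (hx : g • x = x) : g • y = y := by
  refine eq_of_sameInit_of_sameTail (n := n) ?_ (sameTail_smul hg y)
  have := (sameInit_smul_iff hg).2 h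
  rw [hx] at this
  exact this.trans h.symm

/-- An element of `G_n` that moves `x` moves the cylinder of length `n` around `x` off itself. -/
theorem not_sameInit_smul {n : ℕ} {g : B.fullGroup} (hg : g ∈ B.level n) {x y z : B.PathSpace}
    (hx : g • x ≠ x) (hy : SameInit n y x) (hz : SameInit n z x) : ¬ SameInit n (g • y) z := by
  intro h
  refine hx (eq_of_sameInit_of_sameTail (n := n) ?_ (sameTail_smul hg x))
  exact ((sameInit_smul_iff hg).2 hy.symm).trans (h.trans hz)

/-- The transposition of the initial segments of length `m` of two paths with the same tail. -/
noncomputable def swap {m : ℕ} {x y : B.PathSpace} (hxy : SameTail m x y) : B.fullGroup :=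
  ⟨swapHomeo hxy, Set.mem_iUnion.2 ⟨m, swapHomeo_mem hxy⟩⟩

theorem swap_mem_level {m : ℕ} {x y : B.PathSpace} (hxy : SameTail m x y) :
    swap hxy ∈ B.level m := swapHomeo_mem hxy

theorem swap_mul_self {m : ℕ} {x y : B.PathSpace} (hxy : SameTail m x y) :
    swap hxy * swap hxy = 1 :=
  fullGroup_ext fun z => swapFun_swapFun hxy z

theorem swap_smul_left {m : ℕ} {x y : B.PathSpace} (hxy : SameTail m x y) :
    swap hxy • x = y :=
  eq_of_sameInit_of_sameTail (sameInit_swapFun_left hxy (SameInit.refl _ x))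
    ((sameTail_smul (swap_mem_level hxy) x).trans hxy)

theorem swap_smul_right {m : ℕ} {x y : B.PathSpace} (hxy : SameTail m x y) :
    swap hxy • y = x :=
  eq_of_sameInit_of_sameTail (sameInit_swapFun_right hxy (SameInit.refl _ y))
    ((sameTail_smul (swap_mem_level hxy) y).trans hxy.symm)

theorem swap_smul_of_not {m : ℕ} {x y z : B.PathSpace} (hxy : SameTail m x y)
    (h : ¬ SameInit m z x) (h' : ¬ SameInit m z y) : swap hxy • z = z :=
  swapFun_of_not h h'

/-- A transposition inside a cylinder fixes the paths outside of it. -/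
theorem swap_smul_of_not_sameInit {m n : ℕ} (hnm : n ≤ m) {x y z w : B.PathSpace}
    (hxy : SameTail m x y) (hx : SameInit n x w) (hy : SameInit n y w)
    (hz : ¬ SameInit n z w) : swap hxy • z = z :=
  swap_smul_of_not hxy (fun h => hz ((h.mono hnm).trans hx))
    fun h => hz ((h.mono hnm).trans hy)

theorem swap_smul_of_sameTail {m : ℕ} {x y z : B.PathSpace} (hxy : SameTail m x y)
    (hz : SameTail m z x) (h : z ≠ x) (h' : z ≠ y) : swap hxy • z = z :=
  swap_smul_of_not hxy (fun e => h (eq_of_sameInit_of_sameTail e hz))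
    fun e => h' (eq_of_sameInit_of_sameTail e (hz.trans hxy))

/-! ### Conjugacy classes in the full group -/

/-- Homeomorphisms with disjoint supports commute. -/
theorem commute_of_support {g h : B.fullGroup} {A : Set B.PathSpace}
    (hg : ∀ z, z ∉ A → g • z = z) (hh : ∀ z ∈ A, h • z = z) : Commute g h := by
  refine fullGroup_ext fun z => ?_
  rw [mul_smul, mul_smul]
  by_cases hz : z ∈ A
  · have hgz : g • z ∈ A := by
      by_contra hgz
      exact hgz (by rwa [smul_left_cancel g (hg _ hgz)])
    rw [hh z hz, hh _ hgz]
  · have hhz : h • z ∉ A := by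
      intro hhz
      exact hz (by rwa [smul_left_cancel h (hh _ hhz)] at hhz)
    rw [hg z hz, hg _ hhz]

theorem conj_smul_eq {s t : B.fullGroup} {A : Set B.PathSpace}
    (hs : ∀ z, z ∉ A → s • z = z) (ht : ∀ z ∈ A, t⁻¹ • z ∉ A) :
    ∀ z ∈ A, (t * s * t⁻¹) • z = z := by
  intro z hz
  rw [mul_smul, mul_smul, hs _ (ht z hz), smul_inv_smul]

theorem commute_conj {s t : B.fullGroup} {A : Set B.PathSpace}
    (hs : ∀ z, z ∉ A → s • z = z) (ht : ∀ z ∈ A, t⁻¹ • z ∉ A) : Commute s (t * s * t⁻¹) :=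
  commute_of_support hs (conj_smul_eq hs ht)

/-- If the support of `s` is disjoint from its image under the involution `t`, then
`s (t s t⁻¹)` commutes with `t`. -/
theorem commute_mul_conj {s t : B.fullGroup} (ht2 : t * t = 1) {A : Set B.PathSpace}
    (hs : ∀ z, z ∉ A → s • z = z) (ht : ∀ z ∈ A, t⁻¹ • z ∉ A) :
    Commute (s * (t * s * t⁻¹)) t := by
  have h := (commute_conj hs ht).eq
  have ht' : t⁻¹ = t := inv_eq_of_mul_eq_one_left ht2
  rw [ht'] at h ⊢
  simpa [commute_iff_eq, mul_assoc, ht2] using congrArg (· * t) h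

/-- The conjugates of `f` by a family `k y` are distinct if their values single out `y`. -/
theorem card_image_conj [DecidableEq B.fullGroup] (f : B.fullGroup) (k : B.PathSpace → B.fullGroup)
    (S : Finset B.PathSpace)
    (h : ∀ y ∈ S, ∀ y' ∈ S, k y * f * (k y)⁻¹ = k y' * f * (k y')⁻¹ → y = y') :
    (S.image fun y => k y * f * (k y)⁻¹).card = S.card :=
  Finset.card_image_of_injOn fun y hy y' hy' e => h y hy y' hy' e

/-- The case of `f` moving some path to a path outside of its `t`-orbit. -/
theorem exists_conj_of_smul_ne (hB : B.IsSimple) (hX : Infinite B.PathSpace)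
    {t f : B.fullGroup} (ht : t * t = 1) {x : B.PathSpace} (hf : f • x ≠ x)
    (hft : f • x ≠ t • x) (N : ℕ) :
    ∃ F : Finset B.fullGroup, N ≤ F.card ∧ ∀ h ∈ F, ∃ k, Commute k t ∧ h = k * f * k⁻¹ := by
  classical
  obtain ⟨n, hn⟩ := exists_forall_mem_level {t, f}
  have htn : t ∈ B.level n := hn t (by simp)
  have hfn : f ∈ B.level n := hn f (by simp)
  obtain ⟨m, hnm, hS⟩ := exists_finset_sameInit_sameTail hB hX n N
  obtain ⟨S, hSN, hS⟩ := hS x x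
  have ht' : t⁻¹ = t := inv_eq_of_mul_eq_one_left ht
  have hfx : ¬ SameInit n (f • x) x :=
    not_sameInit_smul hfn hf (SameInit.refl _ _) (SameInit.refl _ _)
  have hk : ∀ y ∈ S, ∃ k : B.fullGroup, Commute k t ∧ k • x = y ∧ k • f • x = f • x := by
    intro y hy
    obtain ⟨hyx, hyx'⟩ := hS y hy
    have hs : ∀ z, z ∉ {z | SameInit n z x} → swap hyx'.symm • z = z := fun z hz =>
      swap_smul_of_not_sameInit hnm _ (SameInit.refl _ _) hyx hz
    by_cases htx : t • x = x
    · exact ⟨swap hyx'.symm, commute_of_support hs fun z hz => smul_eq_of_sameInit htn hz htx,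
        swap_smul_left _, hs _ hfx⟩
    · have hA : ∀ z ∈ {z | SameInit n z x}, t⁻¹ • z ∉ {z | SameInit n z x} := by
        intro z hz
        rw [ht']
        exact not_sameInit_smul htn htx hz (SameInit.refl _ _)
      refine ⟨swap hyx'.symm * (t * swap hyx'.symm * t⁻¹), commute_mul_conj ht hs hA, ?_, ?_⟩
      · rw [mul_smul, conj_smul_eq hs hA _ (SameInit.refl _ x), swap_smul_left]
      · have h1 : t • f • x ∉ {z | SameInit n z x} := by
          intro h1
          refine hft (smul_left_cancel t ?_)
          rw [← mul_smul t t x, ht, one_smul]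
          exact eq_of_sameInit_of_sameTail h1
            ((sameTail_smul htn _).trans (sameTail_smul hfn x))
        rw [mul_smul, mul_smul, mul_smul, ht', hs _ h1, ← mul_smul t t, ht, one_smul, hs _ hfx]
  choose! k hkt hkx hkf using hk
  refine ⟨S.image fun y => k y * f * (k y)⁻¹, ?_, ?_⟩
  · rwa [card_image_conj]
    have hval : ∀ y ∈ S, (k y * f * (k y)⁻¹) • y = f • x := fun y hy => by
      rw [mul_smul, mul_smul, inv_smul_eq_iff.2 (hkx y hy).symm, hkf y hy]
    intro y hy y' hy' e
    have := (hval y hy).trans (hval y' hy').symm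
    rw [e] at this
    exact smul_left_cancel _ this
  · intro h hh
    obtain ⟨y, hy, rfl⟩ := Finset.mem_image.1 hh
    exact ⟨k y, hkt y hy, rfl⟩

/-- The case of `f` coinciding with `t` on some of the support of `t` and being trivial
elsewhere. -/
theorem exists_conj_of_forall_smul_eq (hB : B.IsSimple) (hX : Infinite B.PathSpace)
    {t f : B.fullGroup} (ht : t * t = 1) (hf1 : f ≠ 1) (hft : f ≠ t)
    (hf : ∀ x : B.PathSpace, f • x = x ∨ f • x = t • x) (N : ℕ) :
    ∃ F : Finset B.fullGroup, N ≤ F.card ∧ ∀ h ∈ F, ∃ k, Commute k t ∧ h = k * f * k⁻¹ := by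
  classical
  obtain ⟨x, hx⟩ : ∃ x : B.PathSpace, f • x ≠ x := by
    by_contra! h
    exact hf1 (fullGroup_ext h)
  obtain ⟨z, hz⟩ : ∃ z : B.PathSpace, f • z ≠ t • z := by
    by_contra! h
    exact hft (fullGroup_ext h)
  have hfz : f • z = z := (hf z).resolve_right hz
  have htz : t • z ≠ z := fun h => hz (hfz.trans h.symm)
  have hfx : f • x = t • x := (hf x).resolve_left hx
  have htx : t • x ≠ x := hfx ▸ hx
  obtain ⟨n, hn⟩ := exists_forall_mem_level {t, f}
  have htn : t ∈ B.level n := hn t (by simp)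
  have hfn : f ∈ B.level n := hn f (by simp)
  obtain ⟨m, hnm, hS⟩ := exists_finset_sameInit_sameTail hB hX n N
  obtain ⟨S, hSN, hS⟩ := hS z x
  have ht' : t⁻¹ = t := inv_eq_of_mul_eq_one_left ht
  -- the union of two cylinders, one of which is moved by `f` and the other is fixed
  set A : Set B.PathSpace := {w | SameInit n w x ∨ SameInit n w z} with hAdef
  have hfA {w} (hw : SameInit n w x) : f • w ≠ w := fun h => hx
    (smul_eq_of_sameInit hfn hw.symm h)
  have hfA' {w} (hw : SameInit n w z) : f • w = w := smul_eq_of_sameInit hfn hw hfz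
  have htt (w : B.PathSpace) : t • t • w = w := by rw [← mul_smul, ht, one_smul]
  have hA : ∀ w ∈ A, t⁻¹ • w ∉ A := by
    rw [ht']
    rintro w (hw | hw) (h | h)
    · exact not_sameInit_smul htn htx hw (SameInit.refl _ _) h
    · have h1 := (hf w).resolve_left (hfA hw)
      have h2 := hfA' h
      exact hfA hw (h1.trans (smul_left_cancel f (h2.trans h1.symm)))
    · have h1 := (hf _).resolve_left (hfA h)
      rw [htt] at h1
      have h2 := smul_left_cancel f (h1.trans (hfA' hw).symm)
      exact hfA h (by rw [h2]; exact hfA' hw)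
    · exact not_sameInit_smul htn htz hw (SameInit.refl _ _) h
  have hk : ∀ y ∈ S, ∃ k : B.fullGroup, Commute k t ∧ k • x = y ∧
      ∀ y' ∈ S, y' ≠ y → k • y' = y' := by
    intro y hy
    obtain ⟨hyz, hyx⟩ := hS y hy
    have hs : ∀ w, w ∉ A → swap hyx.symm • w = w := fun w hw =>
      swap_smul_of_not _ (fun h => hw (.inl (h.mono hnm)))
        fun h => hw (.inr ((h.mono hnm).trans hyz))
    refine ⟨swap hyx.symm * (t * swap hyx.symm * t⁻¹), commute_mul_conj ht hs hA, ?_, ?_⟩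
    · rw [mul_smul, conj_smul_eq hs hA _ (.inl (SameInit.refl _ x)), swap_smul_left]
    · intro y' hy' hne
      obtain ⟨hyz', hyx'⟩ := hS y' hy'
      rw [mul_smul, conj_smul_eq hs hA _ (.inr hyz')]
      exact swap_smul_of_sameTail _ hyx' (fun h => hx (by rw [← h]; exact hfA' hyz')) hne
  choose! k hkt hkx hky using hk
  refine ⟨S.image fun y => k y * f * (k y)⁻¹, ?_, ?_⟩
  · rwa [card_image_conj]
    have hval : ∀ y ∈ S, (k y * f * (k y)⁻¹) • y = t • y := fun y hy => by
      rw [mul_smul, mul_smul, inv_smul_eq_iff.2 (hkx y hy).symm, hfx, ← mul_smul,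
        (hkt y hy).eq, mul_smul, hkx y hy]
    have hval' : ∀ y ∈ S, ∀ y' ∈ S, y' ≠ y → (k y * f * (k y)⁻¹) • y' = y' :=
      fun y hy y' hy' hne => by
        rw [mul_smul, mul_smul, inv_smul_eq_iff.2 (hky y hy y' hy' hne).symm,
          hfA' (hS y' hy').1, hky y hy y' hy' hne]
    intro y hy y' hy' e
    by_contra hne
    have h1 := hval' y hy y' hy' (Ne.symm hne)
    rw [e, hval y' hy'] at h1
    exact not_sameInit_smul htn htz (hS y' hy').1 (hS y' hy').1
      (by rw [h1]; exact SameInit.refl _ _)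
  · intro h hh
    obtain ⟨y, hy, rfl⟩ := Finset.mem_image.1 hh
    exact ⟨k y, hkt y hy, rfl⟩

/-- An element other than `1` and the involution `t` has infinitely many conjugates by the
centralizer of `t`. -/
theorem exists_conj_commute (hB : B.IsSimple) (hX : Infinite B.PathSpace)
    {t f : B.fullGroup} (ht : t * t = 1) (hf1 : f ≠ 1) (hft : f ≠ t) (N : ℕ) :
    ∃ F : Finset B.fullGroup, N ≤ F.card ∧ ∀ h ∈ F, ∃ k, Commute k t ∧ h = k * f * k⁻¹ := by
  by_cases h : ∀ x : B.PathSpace, f • x = x ∨ f • x = t • x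
  · exact exists_conj_of_forall_smul_eq hB hX ht hf1 hft h N
  · push Not at h
    obtain ⟨x, hx, hx'⟩ := h
    exact exists_conj_of_smul_ne hB hX ht hx hx' N

/-- A normal subgroup containing an element `g` that moves `A` off itself contains all commutators
of elements supported in `A`. Indeed `[a, b] = [a, [b, g]]`. -/
theorem commutator_mem_of_support {H : Subgroup B.fullGroup} (hH : H.Normal)
    {g a b : B.fullGroup} (hg : g ∈ H) {A : Set B.PathSpace} (ha : ∀ z, z ∉ A → a • z = z)
    (hb : ∀ z, z ∉ A → b • z = z) (hA : ∀ z ∈ A, g⁻¹ • z ∉ A) : a * b * a⁻¹ * b⁻¹ ∈ H := by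
  have hb' : ∀ z, z ∉ A → b⁻¹ • z = z := fun z hz => inv_smul_eq_iff.2 (hb z hz).symm
  have hc : Commute a (g * b⁻¹ * g⁻¹) := commute_of_support ha (conj_smul_eq hb' hA)
  have h1 : b * (g * b⁻¹ * g⁻¹) ∈ H := by
    have := mul_mem (hH.conj_mem g hg b) (inv_mem hg)
    simpa [mul_assoc] using this
  have h2 := mul_mem (hH.conj_mem _ h1 a) (inv_mem h1)
  convert h2 using 1
  have h3 : a * (b * (g * b⁻¹ * g⁻¹)) * a⁻¹ = a * b * a⁻¹ * (g * b⁻¹ * g⁻¹) := by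
    rw [mul_assoc (a * b), hc.inv_left.eq]
    simp [mul_assoc]
  rw [h3]
  simp [mul_assoc]

/-- A non-trivial element has infinitely many conjugates by every non-trivial normal subgroup. -/
theorem exists_conj_mem_normal (hB : B.IsSimple) (hX : Infinite B.PathSpace)
    {H : Subgroup B.fullGroup} (hH : H.Normal) {t f : B.fullGroup} (htH : t ∈ H) (ht : t ≠ 1)
    (hf : f ≠ 1) (N : ℕ) :
    ∃ F : Finset B.fullGroup, N ≤ F.card ∧ ∀ h ∈ F, ∃ k ∈ H, h = k * f * k⁻¹ := by
  classical
  obtain ⟨x, hx⟩ : ∃ x : B.PathSpace, f • x ≠ x := by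
    by_contra! h
    exact hf (fullGroup_ext h)
  obtain ⟨z, hz⟩ : ∃ z : B.PathSpace, t • z ≠ z := by
    by_contra! h
    exact ht (fullGroup_ext h)
  obtain ⟨l, hl⟩ := exists_mem_level f
  -- a conjugate `g` of `t` that moves a path `x'` close to `x`
  obtain ⟨m₁, hlm₁, h₁⟩ := exists_sameInit_sameTail hB l
  obtain ⟨x', hx', hx'z⟩ := h₁ x z
  set c := swap hx'z with hc
  set g := c * t * c⁻¹ with hgdef
  have hgH : g ∈ H := hH.conj_mem t htH c
  have hgx : g • x' ≠ x' := by
    have h0 : c • z = x' := swap_smul_right hx'z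
    rw [hgdef, mul_smul, mul_smul, inv_smul_eq_iff.2 h0.symm]
    exact fun h => hz (smul_left_cancel c (h.trans h0.symm))
  obtain ⟨n, hn⟩ := exists_forall_mem_level {g, f}
  have hgn : g ∈ B.level n := hn g (by simp)
  have hgn' : g⁻¹ ∈ B.level n := inv_mem hgn
  have hgx' : g⁻¹ • x' ≠ x' := fun h => hgx (inv_smul_eq_iff.1 h).symm
  have hfn : f ∈ B.level n := hn f (by simp)
  have hfx : f • x' ≠ x' := fun h => hx (smul_eq_of_sameInit hl hx'.symm h)
  set A : Set B.PathSpace := {w | SameInit n w x'} with hAdef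
  have hA : ∀ w ∈ A, g⁻¹ • w ∉ A := fun w hw =>
    not_sameInit_smul hgn' hgx' hw (SameInit.refl _ _)
  have hfA : ∀ w ∈ A, f • w ∉ A := fun w hw =>
    not_sameInit_smul hfn hfx hw (SameInit.refl _ _)
  obtain ⟨m, hnm, hS⟩ := exists_finset_sameInit_sameTail hB hX n (N + 2)
  obtain ⟨S, hSN, hS⟩ := hS x' x'
  obtain ⟨y₁, hy₁⟩ : (S.erase x').Nonempty := by
    rw [← Finset.card_pos]
    have := Finset.pred_card_le_card_erase (s := S) (a := x')
    omega
  obtain ⟨hy₁x, hy₁S⟩ := Finset.mem_erase.1 hy₁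
  obtain ⟨hy₁A, hy₁t⟩ := hS y₁ hy₁S
  have hsupp {y : B.PathSpace} (hyA : SameInit n y x') (hyt : SameTail m x' y) :
      ∀ w, w ∉ A → swap hyt • w = w := fun w hw =>
    swap_smul_of_not_sameInit hnm _ (SameInit.refl _ _) hyA hw
  -- the 3-cycles `[(x' y₁), (x' y)]` lie in `H` and map `y` to `x'`
  have hk : ∀ y ∈ (S.erase x').erase y₁, ∃ k ∈ H, k • y = x' ∧ ∀ w, w ∉ A → k • w = w := by
    intro y hy
    obtain ⟨hyy, hy⟩ := Finset.mem_erase.1 hy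
    obtain ⟨hyx, hyS⟩ := Finset.mem_erase.1 hy
    obtain ⟨hyA, hyt⟩ := hS y hyS
    have ha := hsupp hy₁A hy₁t.symm
    have hb := hsupp hyA hyt.symm
    have ha' : (swap hy₁t.symm)⁻¹ = swap hy₁t.symm := inv_eq_of_mul_eq_one_left (swap_mul_self _)
    have hb' : (swap hyt.symm)⁻¹ = swap hyt.symm := inv_eq_of_mul_eq_one_left (swap_mul_self _)
    refine ⟨_, commutator_mem_of_support hH hgH ha hb hA, ?_, fun w hw => ?_⟩
    · rw [ha', hb', mul_smul, mul_smul, mul_smul, swap_smul_right, swap_smul_left,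
        swap_smul_of_sameTail hyt.symm hy₁t hy₁x hyy.symm, swap_smul_right]
    · rw [ha', hb', mul_smul, mul_smul, mul_smul, hb w hw, ha w hw, hb w hw, ha w hw]
  choose! k hkH hky hkA using hk
  refine ⟨((S.erase x').erase y₁).image fun y => k y * f * (k y)⁻¹, ?_, ?_⟩
  · rw [card_image_conj]
    · have h1 := Finset.pred_card_le_card_erase (s := S) (a := x')
      have h2 := Finset.pred_card_le_card_erase (s := S.erase x') (a := y₁)
      omega
    have hval : ∀ y ∈ (S.erase x').erase y₁, (k y * f * (k y)⁻¹) • x' = f • y := fun y hy => by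
      have hyA : y ∈ A := (hS y (Finset.mem_of_mem_erase (Finset.mem_of_mem_erase hy))).1
      rw [mul_smul, mul_smul, inv_smul_eq_iff.2 (hky y hy).symm, hkA y hy _ (hfA y hyA)]
    intro y hy y' hy' e
    have := (hval y hy).symm
    rw [e, hval y' hy'] at this
    exact smul_left_cancel _ this
  · intro h hh
    obtain ⟨y, hy, rfl⟩ := Finset.mem_image.1 hh
    exact ⟨k y, hkH y hy, rfl⟩

/-- A transposition `s` inside a small cylinder moved by `h` makes `h⁻¹ s h s` an involution. It
commutes with every `c ∈ F` that fixes the cylinder pointwise; otherwise `s c s⁻¹` changes edges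
far beyond those that the elements of `F` can change, and so lies outside of `F`. -/
theorem exists_involution (hB : B.IsSimple) (hX : Infinite B.PathSpace)
    {h : B.fullGroup} (hh : h ≠ 1) (F : Finset B.fullGroup) :
    ∃ s : B.fullGroup, s * s = 1 ∧ (∀ c ∈ F, s * c * s⁻¹ ∈ F → s * c * s⁻¹ = c) ∧
      (h⁻¹ * s * h * s) * (h⁻¹ * s * h * s) = 1 ∧ h⁻¹ * s * h * s ≠ 1 := by
  classical
  obtain ⟨x, hx⟩ : ∃ x : B.PathSpace, h • x ≠ x := by
    by_contra! h0
    exact hh (fullGroup_ext h0)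
  obtain ⟨n, hn⟩ := exists_forall_mem_level (insert h F)
  have hhn : h ∈ B.level n := hn h (by simp)
  have hFn : ∀ c ∈ F, c ∈ B.level n := fun c hc => hn c (by simp [hc])
  obtain ⟨m, hnm, hS⟩ := exists_finset_sameInit_sameTail hB hX n 2
  obtain ⟨S, hSN, hS⟩ := hS x x
  obtain ⟨y, hy⟩ : (S.erase x).Nonempty := by
    rw [← Finset.card_pos]
    have := Finset.pred_card_le_card_erase (s := S) (a := x)
    omega
  obtain ⟨hyx, hyS⟩ := Finset.mem_erase.1 hy
  obtain ⟨hyA, hyt⟩ := hS y hyS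
  set A : Set B.PathSpace := {w | SameInit n w x} with hAdef
  set s := swap hyt.symm with hsdef
  have hs2 : s * s = 1 := swap_mul_self _
  have hs' : s⁻¹ = s := inv_eq_of_mul_eq_one_left hs2
  have hsA : ∀ w, w ∉ A → s • w = w := fun w hw =>
    swap_smul_of_not_sameInit hnm _ (SameInit.refl _ _) hyA hw
  have hsx : s • x = y := swap_smul_left _
  have hsy : s • y = x := swap_smul_right _
  have hhA : ∀ w ∈ A, h⁻¹⁻¹ • w ∉ A := fun w hw => by
    rw [inv_inv]
    exact not_sameInit_smul hhn hx hw (SameInit.refl _ _)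
  refine ⟨s, hs2, fun c hc hsc => ?_, ?_, fun h1 => hyx ?_⟩
  · have hcx : c • x = x := by
      by_contra hcx
      -- otherwise `s c s⁻¹` maps `y` to `c x`, which has another tail
      have h1 : c • x ∉ A :=
        not_sameInit_smul (hFn c hc) hcx (SameInit.refl _ _) (SameInit.refl _ _)
      have h2 : (s * c * s⁻¹) • y = c • x := by
        rw [hs', mul_smul, mul_smul, hsy, hsA _ h1]
      have h3 := sameTail_smul (hFn _ hsc) y
      rw [h2] at h3
      exact hyx (eq_of_sameInit_of_sameTail hyA
        (h3.symm.trans (sameTail_smul (hFn c hc) x)))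
    have : Commute s c :=
      commute_of_support hsA fun w hw => smul_eq_of_sameInit (hFn c hc) hw hcx
    rw [this.eq, mul_inv_cancel_right]
  · have hc : Commute s (h⁻¹ * s * h) := by simpa using commute_conj hsA hhA
    have h2 : (h⁻¹ * s * h) * (h⁻¹ * s * h) = 1 := by
      rw [show (h⁻¹ * s * h) * (h⁻¹ * s * h) = h⁻¹ * (s * s) * h by group, hs2]
      group
    rw [← pow_two, hc.symm.mul_pow, pow_two, pow_two, h2, hs2, one_mul]
  · have h2 := conj_smul_eq hsA hhA y hyA
    rw [inv_inv] at h2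
    have h3 : (h⁻¹ * s * h * s) • x = y := by rw [mul_smul, hsx, h2]
    rw [← h3, h1, one_smul]

end BratteliDiagram

/-! ### The dichotomy for coefficients -/

section Dichotomy

variable {B : BratteliDiagram} {P : VonNeumannAlgebra (EllTwo B.fullGroup)}

open BratteliDiagram

/-- `E_P(u_t)` is a multiple of `u_t` for every involution `t`. -/
theorem mem_or_coeff_eq_zero_of_involution (hB : B.IsSimple) (hX : Infinite B.PathSpace)
    (hP : P ≤ subgroupVN (⊤ : Subgroup B.fullGroup)) (hinv : IsInvariantVN P)
    {t : B.fullGroup} (ht2 : t * t = 1) (ht : t ≠ 1) :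
    leftRegular t ∈ P ∨ ∀ p ∈ P, p (delta 1) t = 0 := by
  refine mem_or_coeff_eq_zero hP fun f hf => ?_
  by_cases hf1 : f = 1
  · -- `δ_1` lies in `L²(P)` and is orthogonal to `δ_t`
    have h1 : delta (1 : B.fullGroup) ∈ ellTwoClosure P := by
      simpa using apply_delta_one_mem (one_mem P)
    have h2 := inner_expectation t h1
    rw [delta_apply_ne ht, inner_delta_right] at h2
    rw [hf1]
    simpa using h2
  · refine apply_eq_zero_of_card fun N => ?_
    obtain ⟨F, hF, h⟩ := exists_conj_commute hB hX ht2 hf1 hf N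
    refine ⟨F, hF, fun g hg => ?_⟩
    obtain ⟨k, hk, rfl⟩ := h g hg
    exact expectation_conj hP hinv hk f

/-- If `P` contains some `u_t` with `t ≠ 1`, then every `E_P(u_g)` is a multiple of `u_g`. -/
theorem mem_or_coeff_eq_zero_of_mem (hB : B.IsSimple) (hX : Infinite B.PathSpace)
    (hP : P ≤ subgroupVN (⊤ : Subgroup B.fullGroup)) (hinv : IsInvariantVN P)
    {t : B.fullGroup} (ht : t ≠ 1) (htP : leftRegular t ∈ P) (g : B.fullGroup) :
    leftRegular g ∈ P ∨ ∀ p ∈ P, p (delta 1) g = 0 := by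
  refine mem_or_coeff_eq_zero hP fun f hf => ?_
  have hf1 : g⁻¹ * f ≠ 1 := fun h => hf (inv_mul_eq_one.1 h).symm
  classical
  suffices h : expectation P g (g * (g⁻¹ * f)) = 0 by simpa using h
  refine apply_eq_zero_of_card fun N => ?_
  obtain ⟨F, hF, h⟩ :=
    exists_conj_mem_normal hB hX hinv.normal_translationSubgroup htP ht hf1 N
  refine ⟨F.map (mulLeftEmbedding g), by simpa using hF, fun x hx => ?_⟩
  obtain ⟨y, hy, rfl⟩ := Finset.mem_map.1 hx
  obtain ⟨k, hk, rfl⟩ := h y hy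
  exact expectation_mul_conj hP hinv hk _

/-- If `P` has no non-zero coefficients at involutions, then it has none outside of `1`. -/
theorem coeff_eq_zero_of_involution (hB : B.IsSimple) (hX : Infinite B.PathSpace)
    (hP : P ≤ subgroupVN (⊤ : Subgroup B.fullGroup)) (hinv : IsInvariantVN P)
    (h : ∀ t : B.fullGroup, t * t = 1 → t ≠ 1 → ∀ p ∈ P, p (delta 1) t = 0)
    {g : B.fullGroup} (hg : g ≠ 1) {p : EllTwo B.fullGroup →L[ℂ] EllTwo B.fullGroup}
    (hp : p ∈ P) : p (delta 1) g = 0 := by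
  have : rightRegular g (p (delta 1)) 1 = 0 := by
    refine apply_one_eq_zero_of_inner_conj fun F => ?_
    obtain ⟨s, hs, hsF, ht, ht1⟩ := exists_involution hB hX hg F
    exact ⟨s, hsF, inner_conj_eq_zero hP hinv hs (h _ ht ht1) hp⟩
  simpa [rightRegular_apply] using this

end Dichotomy

theorem mainTheorem2 (B : BratteliDiagram) (hB : B.IsSimple) (hX : Infinite B.PathSpace) :
    HasISRProperty B.fullGroup := by
  intro P hP hinv
  refine ⟨translationSubgroup P, hinv.normal_translationSubgroup,
    eq_subgroupVN_of_dichotomy hP fun g => ?_⟩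
  by_cases h : ∃ t : B.fullGroup, t * t = 1 ∧ t ≠ 1 ∧ leftRegular t ∈ P
  · obtain ⟨t, -, ht, htP⟩ := h
    exact mem_or_coeff_eq_zero_of_mem hB hX hP hinv ht htP g
  · by_cases hg : g = 1
    · subst hg
      exact .inl (mem_translationSubgroup.1 (one_mem _))
    · refine .inr fun p hp => coeff_eq_zero_of_involution hB hX hP hinv (fun t ht2 ht => ?_) hg hp
      exact (mem_or_coeff_eq_zero_of_involution hB hX hP hinv ht2 ht).resolve_left
        fun htP => h ⟨t, ht2, ht, htP⟩
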